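/- Let $Y$ be a random variable with values in $\mathbb N_0=\{0,1,2,\dots\}$, with $p_n=\mathbf P[Y=n]>0$ for every $n\in\mathbb N_0$ and $\mathbf E[Y^k]<\infty$ for all $k=1,2,\dots$. Suppose that for some integer $n_0\ge 2$ $$\sum_{n\ge n_0}\frac{-\ln p_n}{n^2\,\ln n}=\infty ,$$ and that the sequence $$\frac{-\ln(\tfrac12 p_n)}{\ln n},\qquad n\ge n_0,$$ is monotone increasing (not necessarily strictly) and tends to $\infty$ as $n\to\infty$. Then $Y$ satisfies Carleman's condition (Stieltjes case) $$\sum_{k=1}^{\infty}\bigl(\mathbf E[Y^k]\bigr)^{-1/(2k)}=\infty ,$$ and $Y$ is moment-determinate: its distribution is the only probability distribution on $\mathbb R$ (in particular, the only one on $\mathbb R_+=[0,\infty)$) with the moments $\mathbf E[Y^k]$, $k\ge1$. Moreover, $Y^2$ is moment-determinate on $\mathbb R_+$: its distribution is the only probability distribution on $\mathbb R_+$ with the moments $\mathbf E[Y^{2k}]$, $k\ge1$. -/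

import Mathlib

open MeasureTheory ProbabilityTheory Filter

/-- Carleman's condition in the Stieltjes case, for a distribution `μ` on the half-line `[0, ∞)`
with positive moments `m_k = ∫ x ^ k dμ`: the series `∑_{k ≥ 1} m_k ^ (-1 / (2 k))` diverges
to `+∞`. -/
def StieltjesCarleman (μ : Measure ℝ) : Prop :=
  Tendsto (fun N : ℕ => ∑ k ∈ Finset.Icc 1 N, (moment id k μ) ^ (-(1 / (2 * (k : ℝ))))) atTop atTop

/-- All moments of `μ` are finite (absolutely convergent). -/
def FiniteMoments (μ : Measure ℝ) : Prop :=
  ∀ k : ℕ, Integrable (fun x : ℝ => x ^ k) μ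

/-- `μ` is moment-determinate on `S`: it is carried by `S`, has finite moments of all orders, and
is the only probability distribution carried by `S` that has these moments. -/
def MomentDeterminateOn (S : Set ℝ) (μ : Measure ℝ) : Prop :=
  μ Sᶜ = 0 ∧ FiniteMoments μ ∧
    ∀ ν : Measure ℝ, IsProbabilityMeasure ν → ν Sᶜ = 0 → FiniteMoments ν →
      (∀ k : ℕ, 1 ≤ k → moment id k ν = moment id k μ) → ν = μ

/-! Write `p n = 2 n ^ (-a n)`, with `a` increasing to infinity, and let `N k` be the first `n ≥ n₀`
with `a n ≥ k + 3`. Splitting the `(k + 1)`-st moment at `N k` gives `m (k + 1) ≤ N k * m k +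
const`, hence `m (k + 1) ≤ R k * m k` with `R k = C * N k` monotone
(`exists_moment_ratio_majorant`). Counting the `k` with `N k ≤ n` turns the divergence of `∑ a n / n
^ 2` into that of `∑ 1 / N k`. Carleman's condition follows from `m k ≤ R k ^ k` and `R k ≥ 1`.

Determinacy is quasi-analyticity: the difference of two characteristic functions with equal moments
is flat at `0`, its derivatives are bounded by absolute moments, and Bang's argument
(`eq_zero_of_taylor_bound`) makes it vanish. For `Y ^ 2`, symmetrized square roots reduce the
half-line to the line; both cases use the majorant `R (2 * k + 1)`. -/

/-! ### Taylor remainder of the exponential. -/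

/-- The derivative of the remainder of order `n + 1` is `c` times that of order `n`, so the bounds
integrate inductively from `‖exp (y * c)‖ ≤ 1`. -/
lemma norm_exp_mul_sub_sum_le {c : ℂ} (hc : c.re ≤ 0) (n : ℕ) {y : ℝ} (hy : 0 ≤ y) :
    ‖Complex.exp (y * c) - ∑ j ∈ Finset.range n, (y * c) ^ j / (j.factorial : ℂ)‖
      ≤ ‖c‖ ^ n * (y ^ n / n.factorial) := by
  induction n generalizing y with
  | zero =>
    simp only [Finset.range_zero, Finset.sum_empty, sub_zero, pow_zero, Nat.factorial_zero,
      Nat.cast_one, div_one, mul_one]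
    rw [Complex.norm_exp, Real.exp_le_one_iff]
    simpa using mul_nonpos_of_nonneg_of_nonpos hy hc
  | succ n ih =>
    have hsum : ∀ x : ℝ, HasDerivAt (fun x : ℝ =>
        ∑ j ∈ Finset.range (n + 1), (x * c) ^ j / (j.factorial : ℂ))
        (c * ∑ j ∈ Finset.range n, (x * c) ^ j / (j.factorial : ℂ)) x := by
      intro x
      simp only [Finset.sum_range_succ', pow_zero, Finset.mul_sum]
      refine HasDerivAt.add_const _ (HasDerivAt.fun_sum fun j _ => ?_)
      have h := ((((hasDerivAt_id x).ofReal_comp).mul_const c).pow (j + 1)).div_const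
        ((j + 1).factorial : ℂ)
      refine h.congr_deriv ?_
      have h1 : (j.factorial : ℂ) ≠ 0 := by exact_mod_cast j.factorial_ne_zero
      have h2 : (j : ℂ) + 1 ≠ 0 := by exact_mod_cast j.succ_ne_zero
      simp only [Nat.factorial_succ, id, Nat.add_sub_cancel]
      push_cast
      field_simp
    have hexp : ∀ x : ℝ, HasDerivAt (fun x : ℝ => Complex.exp (x * c))
        (c * Complex.exp (x * c)) x := by
      intro x
      have h := (((hasDerivAt_id x).ofReal_comp).mul_const c).cexp
      refine h.congr_deriv ?_
      simp [mul_comm]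
    have hf : ∀ x : ℝ, HasDerivAt (fun x : ℝ => Complex.exp (x * c) -
        ∑ j ∈ Finset.range (n + 1), (x * c) ^ j / (j.factorial : ℂ))
        (c * (Complex.exp (x * c) - ∑ j ∈ Finset.range n, (x * c) ^ j / (j.factorial : ℂ))) x := by
      intro x
      rw [mul_sub]
      exact (hexp x).sub (hsum x)
    have hB : ∀ x : ℝ, HasDerivAt (fun x : ℝ => ‖c‖ ^ (n + 1) * (x ^ (n + 1) / (n + 1).factorial))
        (‖c‖ ^ (n + 1) * (x ^ n / n.factorial)) x := by
      intro x
      refine (((hasDerivAt_pow (n + 1) x).div_const _).const_mul _).congr_deriv ?_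
      have h1 : (n.factorial : ℝ) ≠ 0 := by exact_mod_cast n.factorial_ne_zero
      have h2 : (n : ℝ) + 1 ≠ 0 := by positivity
      simp only [Nat.factorial_succ, Nat.add_sub_cancel]
      push_cast
      field_simp
    refine image_norm_le_of_norm_deriv_right_le_deriv_boundary
      (fun x _ => (hf x).continuousAt.continuousWithinAt)
      (fun x _ => (hf x).hasDerivWithinAt) ?_ hB (fun x hx => ?_) (Set.right_mem_Icc.2 hy)
    · simp [Finset.sum_range_succ']
    · rw [norm_mul, pow_succ', mul_assoc]
      exact mul_le_mul_of_nonneg_left (ih hx.1) (norm_nonneg _)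

lemma norm_exp_ofReal_mul_I_sub_sum_le (y : ℝ) (n : ℕ) :
    ‖Complex.exp (y * Complex.I) - ∑ j ∈ Finset.range n, (y * Complex.I) ^ j / (j.factorial : ℂ)‖
      ≤ |y| ^ n / n.factorial := by
  -- Putting `y` into `c` and evaluating at `1` covers both signs of `y`.
  have h := norm_exp_mul_sub_sum_le (c := y * Complex.I) (by simp) n zero_le_one
  simpa [div_eq_mul_inv] using h

/-! ### Quasi-analyticity. -/

/-- Bang's form of the Denjoy–Carleman quasi-analyticity argument. -/
lemma norm_le_exp_mul_of_taylor_bound {g : ℕ → ℝ → ℂ} {M r : ℕ → ℝ}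
    (hT : ∀ n m t h, ‖g n (t + h)‖ ≤
      ∑ j ∈ Finset.range m, |h| ^ j / j.factorial * ‖g (n + j) t‖ +
        |h| ^ m / m.factorial * M (n + m))
    (hM : ∀ n, M (n + 1) ≤ r n * M n) (hM0 : ∀ n, 0 ≤ M n) (hr : ∀ n, 0 < r n)
    (hmono : Monotone r) (K : ℕ) {s h : ℝ}
    (hs : ∀ j, ‖g j s‖ ≤ Real.exp (j - (K + 1 : ℕ)) * M j)
    (hh : |h| ≤ 1 / (Real.exp 1 * r K)) (j : ℕ) :
    ‖g j (s + h)‖ ≤ Real.exp (j - K) * M j := by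
  have hgM : ∀ n t, ‖g n t‖ ≤ M n := fun n t => by simpa using hT n 0 t 0
  rcases le_or_gt K j with hj | hj
  · refine (hgM _ _).trans (le_mul_of_one_le_left (hM0 j) (Real.one_le_exp ?_))
    simpa using hj
  · have hpow : ∀ i, j + i ≤ K + 1 → M (j + i) ≤ r K ^ i * M j := by
      intro i
      induction i with
      | zero => simp
      | succ i ih =>
        intro hi
        calc M (j + (i + 1)) ≤ r (j + i) * M (j + i) := hM _
          _ ≤ r K * (r K ^ i * M j) :=
            mul_le_mul (hmono (by omega)) (ih (by omega)) (hM0 _) (hr K).le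
          _ = r K ^ (i + 1) * M j := by ring
    -- Since `x ≤ 1`, the Taylor sum costs at most a factor `e`: one level of flatness, from `K + 1`
    -- to `K`.
    set x : ℝ := Real.exp 1 * r K * |h| with hx
    have hx0 : 0 ≤ x := by have := hr K; positivity
    have hx1 : x ≤ 1 := by
      have h0 : 0 < Real.exp 1 * r K := mul_pos (Real.exp_pos _) (hr K)
      rw [le_div_iff₀ h0] at hh
      rw [hx]; linarith
    have key : ∀ i, j + i ≤ K + 1 → |h| ^ i / i.factorial *
        (Real.exp ((j + i : ℕ) - (K + 1 : ℕ)) * M (j + i)) ≤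
        Real.exp (j - (K + 1 : ℕ)) * M j * (x ^ i / i.factorial) := by
      intro i hi
      have he : Real.exp ((j + i : ℕ) - (K + 1 : ℕ)) =
          Real.exp (j - (K + 1 : ℕ)) * Real.exp 1 ^ i := by
        rw [← Real.exp_nat_mul, ← Real.exp_add]
        congr 1
        push_cast
        ring
      rw [he]
      calc _ ≤ |h| ^ i / i.factorial * (Real.exp (j - (K + 1 : ℕ)) * Real.exp 1 ^ i *
            (r K ^ i * M j)) := by
            gcongr
            exact hpow i hi
        _ = _ := by rw [hx]; ring
    -- At order `K + 1` the weight in `hs` is `1`, so the remainder is just the next term of the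
    -- exponential sum.
    obtain ⟨m, hm⟩ : ∃ m, j + m = K + 1 := ⟨K + 1 - j, by omega⟩
    calc ‖g j (s + h)‖ ≤ ∑ i ∈ Finset.range m, |h| ^ i / i.factorial * ‖g (j + i) s‖ +
        |h| ^ m / m.factorial * M (j + m) := hT j m s h
      _ ≤ ∑ i ∈ Finset.range m, Real.exp (j - (K + 1 : ℕ)) * M j * (x ^ i / i.factorial) +
          Real.exp (j - (K + 1 : ℕ)) * M j * (x ^ m / m.factorial) := by
        refine add_le_add (Finset.sum_le_sum fun i hi => ?_) ?_
        · refine le_trans ?_ (key i (by have := Finset.mem_range.1 hi; omega))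
          gcongr
          exact hs _
        · refine le_trans (le_of_eq ?_) (key m hm.le)
          rw [hm]; simp
      _ = Real.exp (j - (K + 1 : ℕ)) * M j * ∑ i ∈ Finset.range (m + 1), x ^ i / i.factorial := by
        rw [Finset.sum_range_succ, mul_add, Finset.mul_sum]
      _ ≤ Real.exp (j - (K + 1 : ℕ)) * M j * Real.exp 1 := by
        have := hM0 j
        gcongr
        exact (Real.sum_le_exp_of_nonneg hx0 _).trans (Real.exp_le_exp.2 hx1)
      _ = Real.exp (j - K) * M j := by
        rw [mul_right_comm, ← Real.exp_add]
        congr 2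
        push_cast
        ring

/-- A quasi-analytic function that is flat at the origin vanishes. -/
theorem eq_zero_of_taylor_bound {g : ℕ → ℝ → ℂ} {M r : ℕ → ℝ}
    (hT : ∀ n m t h, ‖g n (t + h)‖ ≤
      ∑ j ∈ Finset.range m, |h| ^ j / j.factorial * ‖g (n + j) t‖ +
        |h| ^ m / m.factorial * M (n + m))
    (hM : ∀ n, M (n + 1) ≤ r n * M n) (hr : ∀ n, 0 < r n)
    (hmono : Monotone r) (hsum : ¬ Summable fun n => 1 / r n) (h0 : ∀ n, g n 0 = 0) (t : ℝ) :
    g 0 t = 0 := by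
  have hgM : ∀ n t, ‖g n t‖ ≤ M n := fun n t => by simpa using hT n 0 t 0
  have hM0 : ∀ n, 0 ≤ M n := fun n => (norm_nonneg _).trans (hgM n 0)
  have hδ : ∀ i, 0 < 1 / (Real.exp 1 * r i) := fun i =>
    one_div_pos.2 (mul_pos (Real.exp_pos _) (hr i))
  -- Starting from `0`, flat to every level, each of the `d` moves loses one level; the last one has
  -- length at most `1 / (e * r K)`.
  have step : ∀ d K : ℕ, ∀ t : ℝ, |t| ≤ ∑ i ∈ Finset.range d, 1 / (Real.exp 1 * r (K + i)) →
      ∀ j : ℕ, ‖g j t‖ ≤ Real.exp (j - K) * M j := by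
    intro d
    induction d with
    | zero =>
      intro K t ht j
      have : t = 0 := by simpa using ht
      rw [this, h0, norm_zero]
      exact mul_nonneg (Real.exp_pos _).le (hM0 j)
    | succ d ih =>
      intro K t ht j
      rw [Finset.sum_range_succ'] at ht
      set T := ∑ i ∈ Finset.range d, 1 / (Real.exp 1 * r (K + 1 + i)) with hTdef
      have hTeq : ∑ i ∈ Finset.range d, 1 / (Real.exp 1 * r (K + (i + 1))) = T :=
        Finset.sum_congr rfl fun i _ => by rw [add_assoc, add_comm 1 i]
      rw [hTeq, add_zero] at ht
      have hT0 : 0 ≤ T := Finset.sum_nonneg fun i _ => (hδ _).le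
      obtain ⟨s, hs, hst⟩ : ∃ s, |s| ≤ T ∧ |t - s| ≤ 1 / (Real.exp 1 * r K) := by
        have := hδ K
        rcases abs_le.1 ht with ⟨h1, h2⟩
        rcases le_total t (-T) with h | h
        · exact ⟨-T, by rw [abs_neg, abs_of_nonneg hT0], abs_le.2 ⟨by linarith, by linarith⟩⟩
        · rcases le_total t T with h' | h'
          · exact ⟨t, abs_le.2 ⟨h, h'⟩, by rw [sub_self, abs_zero]; exact this.le⟩
          · exact ⟨T, by rw [abs_of_nonneg hT0], abs_le.2 ⟨by linarith, by linarith⟩⟩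
      have := norm_le_exp_mul_of_taylor_bound hT hM hM0 hr hmono K (ih (K + 1) s hs) hst j
      rwa [add_sub_cancel] at this
  -- The tail of `∑ 1 / r` still diverges, so `t` is reached from any level `K`.
  have hbound : ∀ K : ℕ, ‖g 0 t‖ ≤ Real.exp (-(K : ℝ)) * M 0 := by
    intro K
    have hns : ¬ Summable fun i => 1 / (Real.exp 1 * r (K + i)) := by
      intro h
      apply hsum
      rw [← summable_nat_add_iff K]
      refine (h.mul_left (Real.exp 1)).congr fun i => ?_
      have := (hr (K + i)).ne'
      have := (Real.exp_pos 1).ne'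
      rw [add_comm i K]
      field_simp
    rw [not_summable_iff_tendsto_nat_atTop_of_nonneg fun i => (hδ _).le] at hns
    obtain ⟨d, hd⟩ := (hns.eventually_ge_atTop |t|).exists
    simpa using step d K t hd 0
  have hlim : Tendsto (fun K : ℕ => Real.exp (-(K : ℝ)) * M 0) atTop (nhds 0) := by
    have h := (Real.tendsto_exp_neg_atTop_nhds_zero.comp tendsto_natCast_atTop_atTop).mul_const
      (M 0)
    simpa using h
  exact norm_le_zero_iff.1 (ge_of_tendsto' hlim hbound)

/-! ### Uniqueness on the line. -/

/-- The `n`-th derivative of the characteristic function of `μ`. -/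
noncomputable def charFunDeriv (μ : Measure ℝ) (n : ℕ) (t : ℝ) : ℂ :=
  ∫ x : ℝ, (x * Complex.I) ^ n * Complex.exp (t * x * Complex.I) ∂μ

lemma FiniteMoments.integrable_abs_pow {μ : Measure ℝ} (hμ : FiniteMoments μ) (n : ℕ) :
    Integrable (fun x : ℝ => |x| ^ n) μ := by
  simpa [abs_pow] using (hμ n).abs

lemma FiniteMoments.integrable_pow_mul_exp {μ : Measure ℝ} (hμ : FiniteMoments μ) (n : ℕ) (t : ℝ) :
    Integrable (fun x : ℝ => ((x : ℂ) * Complex.I) ^ n * Complex.exp (t * x * Complex.I)) μ := by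
  refine (hμ.integrable_abs_pow n).mono' (by fun_prop) (ae_of_all _ fun x => ?_)
  have h : ‖Complex.exp (t * x * Complex.I)‖ = 1 := by
    exact_mod_cast Complex.norm_exp_ofReal_mul_I (t * x)
  simp [h]

lemma norm_charFunDeriv_add_sub_sum_le {μ : Measure ℝ} (hμ : FiniteMoments μ) (n m : ℕ)
    (t h : ℝ) :
    ‖charFunDeriv μ n (t + h) -
        ∑ j ∈ Finset.range m, ((h : ℂ) ^ j / j.factorial) * charFunDeriv μ (n + j) t‖ ≤
      |h| ^ m / m.factorial * ∫ x, |x| ^ (n + m) ∂μ := by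
  have hint : ∀ j ∈ Finset.range m, Integrable (fun x : ℝ => ((h : ℂ) ^ j / j.factorial) *
      (((x : ℂ) * Complex.I) ^ (n + j) * Complex.exp (t * x * Complex.I))) μ :=
    fun j _ => (hμ.integrable_pow_mul_exp (n + j) t).const_mul _
  simp only [charFunDeriv]
  simp_rw [← integral_const_mul]
  rw [← integral_finsetSum _ hint,
    ← integral_sub (hμ.integrable_pow_mul_exp n (t + h)) (integrable_finsetSum _ hint)]
  refine norm_integral_le_of_norm_le ((hμ.integrable_abs_pow (n + m)).const_mul _)
    (ae_of_all _ fun x => ?_)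
  have h1 : ((x : ℂ) * Complex.I) ^ n * Complex.exp ((t + h : ℝ) * x * Complex.I) -
      ∑ j ∈ Finset.range m, ((h : ℂ) ^ j / j.factorial) *
        (((x : ℂ) * Complex.I) ^ (n + j) * Complex.exp (t * x * Complex.I)) =
      ((x : ℂ) * Complex.I) ^ n * Complex.exp ((t * x : ℝ) * Complex.I) *
        (Complex.exp ((h * x : ℝ) * Complex.I) -
          ∑ j ∈ Finset.range m, ((h * x : ℝ) * Complex.I) ^ j / (j.factorial : ℂ)) := by
    have he : Complex.exp ((t + h : ℝ) * x * Complex.I) =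
        Complex.exp ((t * x : ℝ) * Complex.I) * Complex.exp ((h * x : ℝ) * Complex.I) := by
      rw [← Complex.exp_add]
      congr 1
      push_cast
      ring
    rw [mul_sub, Finset.mul_sum, he, ← mul_assoc]
    congr 1
    refine Finset.sum_congr rfl fun j _ => ?_
    push_cast
    ring
  rw [h1, norm_mul, norm_mul, Complex.norm_exp_ofReal_mul_I]
  calc _ ≤ |x| ^ n * (|h * x| ^ m / m.factorial) := by
        gcongr
        · simp
        · exact norm_exp_ofReal_mul_I_sub_sum_le _ _
    _ = _ := by rw [abs_mul, mul_pow]; ring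

/-- A Carleman-type uniqueness theorem for the Hamburger moment problem: the divergence condition
is put on a monotone majorant of the ratios of consecutive even moments. -/
theorem measure_eq_of_moments_eq {μ ν : Measure ℝ} [IsFiniteMeasure μ] [IsFiniteMeasure ν]
    (hμ : FiniteMoments μ) (hν : FiniteMoments ν) (heq : ∀ k : ℕ, ∫ x, x ^ k ∂μ = ∫ x, x ^ k ∂ν)
    {l : ℕ → ℝ} (hl : Monotone l) (hpos : ∀ k, 0 < l k)
    (hratio : ∀ k, ∫ x, x ^ (2 * (k + 1)) ∂μ ≤ l k ^ 2 * ∫ x, x ^ (2 * k) ∂μ)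
    (hsum : ¬ Summable fun k => 1 / l k) : μ = ν := by
  set m : ℕ → ℝ := fun k => ∫ x, x ^ (2 * k) ∂μ with hm
  -- AM-GM: `|x| ^ (2k+1) ≤ (l / 2) x ^ (2k) + x ^ (2k+2) / (2 l)`.
  have hodd : ∀ (ρ : Measure ℝ), FiniteMoments ρ → (∀ k, ∫ x, x ^ (2 * k) ∂ρ = m k) →
      ∀ k, ∫ x, |x| ^ (2 * k + 1) ∂ρ ≤ l k * m k := by
    intro ρ hρ hρm k
    have hlk := hpos k
    calc ∫ x, |x| ^ (2 * k + 1) ∂ρ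
        ≤ ∫ x, (l k / 2 * x ^ (2 * k) + (1 / (2 * l k)) * x ^ (2 * (k + 1))) ∂ρ := by
          refine integral_mono (hρ.integrable_abs_pow _)
            (((hρ _).const_mul _).add ((hρ _).const_mul _)) fun x => ?_
          have h2 : x ^ (2 * k) = |x| ^ (2 * k) := by rw [pow_mul, pow_mul, sq_abs]
          have h3 : x ^ (2 * (k + 1)) = |x| ^ (2 * (k + 1)) := by rw [pow_mul, pow_mul, sq_abs]
          simp only [h2, h3]
          have h4 : 0 ≤ |x| ^ (2 * k) * ((l k - |x|) ^ 2 / (2 * l k)) := by positivity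
          have h5 : l k / 2 * |x| ^ (2 * k) + (1 / (2 * l k)) * |x| ^ (2 * (k + 1)) -
              |x| ^ (2 * k + 1) = |x| ^ (2 * k) * ((l k - |x|) ^ 2 / (2 * l k)) := by
            field_simp
            ring
          linarith
      _ = l k / 2 * m k + (1 / (2 * l k)) * m (k + 1) := by
          rw [integral_add ((hρ _).const_mul _) ((hρ _).const_mul _), integral_const_mul,
            integral_const_mul, hρm, hρm]
      _ ≤ l k / 2 * m k + (1 / (2 * l k)) * (l k ^ 2 * m k) := by
          gcongr
          exact hratio k
      _ = l k * m k := by field_simp; ring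
  -- At odd orders the majorant `l k * m k` replaces the absolute moment, so that successive ratios
  -- are at most `l (n / 2)`; the `2` accounts for `μ` and `ν`.
  set M : ℕ → ℝ := fun n => 2 * ((if Even n then 1 else l (n / 2)) * m (n / 2)) with hM
  have hMe : ∀ k, M (2 * k) = 2 * m k := fun k => by simp [hM]
  have hMo : ∀ k, M (2 * k + 1) = 2 * (l k * m k) := fun k => by
    have : (2 * k + 1) / 2 = k := by omega
    simp [hM, this]
  have habs : ∀ n, (∫ x, |x| ^ n ∂μ) + ∫ x, |x| ^ n ∂ν ≤ M n := by
    intro n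
    rcases Nat.even_or_odd' n with ⟨k, rfl | rfl⟩
    · have h2 : ∀ x : ℝ, |x| ^ (2 * k) = x ^ (2 * k) := fun x => by
        rw [pow_mul, pow_mul, sq_abs]
      simp only [h2, hMe, ← heq]
      exact (two_mul _).ge
    · rw [hMo]
      linarith [hodd μ hμ (fun _ => rfl) k, hodd ν hν (fun j => (heq (2 * j)).symm) k]
  set g : ℕ → ℝ → ℂ := fun n t => charFunDeriv μ n t - charFunDeriv ν n t with hg
  have hT : ∀ n k t h, ‖g n (t + h)‖ ≤
      ∑ j ∈ Finset.range k, |h| ^ j / j.factorial * ‖g (n + j) t‖ +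
        |h| ^ k / k.factorial * M (n + k) := by
    intro n k t h
    have e1 := norm_charFunDeriv_add_sub_sum_le hμ n k t h
    have e2 := norm_charFunDeriv_add_sub_sum_le hν n k t h
    have e3 : g n (t + h) = ∑ j ∈ Finset.range k, ((h : ℂ) ^ j / j.factorial) * g (n + j) t +
        ((charFunDeriv μ n (t + h) -
          ∑ j ∈ Finset.range k, ((h : ℂ) ^ j / j.factorial) * charFunDeriv μ (n + j) t) -
        (charFunDeriv ν n (t + h) -
          ∑ j ∈ Finset.range k, ((h : ℂ) ^ j / j.factorial) * charFunDeriv ν (n + j) t)) := by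
      simp only [hg, mul_sub, Finset.sum_sub_distrib]
      ring
    rw [e3]
    refine (norm_add_le _ _).trans (add_le_add ?_ ?_)
    · refine (norm_sum_le _ _).trans (Finset.sum_le_sum fun j _ => ?_)
      simp
    · refine (norm_sub_le _ _).trans ((add_le_add e1 e2).trans ?_)
      rw [← mul_add]
      exact mul_le_mul_of_nonneg_left (habs _) (by positivity)
  have hMr : ∀ n, M (n + 1) ≤ l (n / 2) * M n := by
    intro n
    rcases Nat.even_or_odd' n with ⟨k, rfl | rfl⟩
    · rw [hMo, hMe, Nat.mul_div_cancel_left _ two_pos]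
      exact le_of_eq (by ring)
    · rw [show 2 * k + 1 + 1 = 2 * (k + 1) by ring, hMe, hMo,
        show (2 * k + 1) / 2 = k by omega]
      have : m (k + 1) ≤ l k ^ 2 * m k := hratio k
      nlinarith
  have h0 : ∀ n, g n 0 = 0 := by
    intro n
    have : ∀ ρ : Measure ℝ, charFunDeriv ρ n 0 = Complex.I ^ n * ((∫ x, x ^ n ∂ρ : ℝ) : ℂ) := by
      intro ρ
      rw [← integral_complex_ofReal, ← integral_const_mul]
      simp [charFunDeriv, mul_pow, mul_comm]
    simp only [hg, this, heq, sub_self]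
  refine Measure.ext_of_charFun (funext fun t => ?_)
  have hzero := eq_zero_of_taylor_bound (r := fun n => l (n / 2)) hT hMr (fun n => hpos _)
    (fun a b hab => hl (Nat.div_le_div_right hab)) (fun h => hsum ?_) h0 t
  · simp only [hg, charFunDeriv, pow_zero, one_mul, sub_eq_zero] at hzero
    simpa only [charFun_apply_real] using hzero
  · have := h.comp_injective (i := fun k : ℕ => 2 * k) (fun a b hab => by simpa using hab)
    refine this.congr fun k => ?_
    simp

/-! ### Uniqueness on the half-line. -/

/-- The symmetric measure on the line whose image under squaring is `2 μ`, for `μ` carried by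
`[0, ∞)`. -/
noncomputable def sqrtSymm (μ : Measure ℝ) : Measure ℝ :=
  μ.map (fun x => √x) + μ.map (fun x => -√x)

instance (μ : Measure ℝ) [IsFiniteMeasure μ] : IsFiniteMeasure (sqrtSymm μ) := by
  unfold sqrtSymm
  infer_instance

lemma FiniteMoments.integrable_sqrt_pow {μ : Measure ℝ} [IsFiniteMeasure μ] (hμ : FiniteMoments μ)
    (n : ℕ) : Integrable (fun x : ℝ => √x ^ n) μ := by
  refine ((integrable_const 1).add (hμ.integrable_abs_pow n)).mono' (by fun_prop)
    (ae_of_all _ fun x => ?_)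
  rw [Real.norm_of_nonneg (by positivity)]
  have h : (√x ^ n) ^ 2 ≤ |x| ^ n := by
    rw [← pow_mul, mul_comm, pow_mul]
    refine pow_le_pow_left₀ (sq_nonneg _) ?_ n
    rcases le_total 0 x with hx | hx
    · rw [Real.sq_sqrt hx]; exact le_abs_self x
    · rw [Real.sqrt_eq_zero_of_nonpos hx]; simp
  simp only [Pi.add_apply]
  nlinarith [sq_nonneg (√x ^ n - 1)]

lemma FiniteMoments.integrable_neg_sqrt_pow {μ : Measure ℝ} [IsFiniteMeasure μ]
    (hμ : FiniteMoments μ) (n : ℕ) : Integrable (fun x : ℝ => (-√x) ^ n) μ := by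
  simp_rw [neg_pow (√_) n]
  exact (hμ.integrable_sqrt_pow n).const_mul _

lemma FiniteMoments.sqrtSymm {μ : Measure ℝ} [IsFiniteMeasure μ] (hμ : FiniteMoments μ) :
    FiniteMoments (sqrtSymm μ) := by
  intro n
  refine Integrable.add_measure ?_ ?_
  · rw [integrable_map_measure (by fun_prop) (by fun_prop)]
    exact hμ.integrable_sqrt_pow n
  · rw [integrable_map_measure (by fun_prop) (by fun_prop)]
    exact hμ.integrable_neg_sqrt_pow n

lemma integral_pow_sqrtSymm {μ : Measure ℝ} [IsFiniteMeasure μ] (hμ : FiniteMoments μ) (n : ℕ) :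
    ∫ x, x ^ n ∂(sqrtSymm μ) = (1 + (-1) ^ n) * ∫ x, √x ^ n ∂μ := by
  have h := hμ.sqrtSymm n
  unfold sqrtSymm at h ⊢
  rw [integral_add_measure h.left_of_add_measure h.right_of_add_measure,
    integral_map (by fun_prop) (by fun_prop), integral_map (by fun_prop) (by fun_prop)]
  simp_rw [neg_pow (√_) n]
  rw [integral_const_mul]
  ring

lemma integral_even_pow_sqrtSymm {μ : Measure ℝ} [IsFiniteMeasure μ] (hμ : FiniteMoments μ)
    (h0 : μ (Set.Ici 0)ᶜ = 0) (k : ℕ) :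
    ∫ x, x ^ (2 * k) ∂(sqrtSymm μ) = 2 * ∫ x, x ^ k ∂μ := by
  have hae : ∀ᵐ x ∂μ, x ∈ Set.Ici (0 : ℝ) := h0
  rw [integral_pow_sqrtSymm hμ, integral_congr_ae (g := fun x => x ^ k)]
  · norm_num [pow_mul]
  · filter_upwards [hae] with x hx
    rw [pow_mul, Real.sq_sqrt hx]

lemma map_sq_sqrtSymm {μ : Measure ℝ} (h0 : μ (Set.Ici 0)ᶜ = 0) :
    (sqrtSymm μ).map (fun x => x ^ 2) = μ + μ := by
  have hae : ∀ᵐ x ∂μ, x ∈ Set.Ici (0 : ℝ) := h0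
  have h : μ.map (fun x => √x ^ 2) = μ := by
    conv_rhs => rw [← Measure.map_id (μ := μ)]
    refine Measure.map_congr ?_
    filter_upwards [hae] with x hx
    rw [Real.sq_sqrt hx, id]
  unfold sqrtSymm
  rw [Measure.map_add _ _ (by fun_prop), Measure.map_map (by fun_prop) (by fun_prop),
    Measure.map_map (by fun_prop) (by fun_prop)]
  simp only [Function.comp_def, neg_sq, h]

/-- A Carleman-type uniqueness theorem for the Stieltjes moment problem. -/
theorem measure_eq_of_moments_eq_of_nonneg {μ ν : Measure ℝ} [IsFiniteMeasure μ]
    [IsFiniteMeasure ν] (hμ0 : μ (Set.Ici 0)ᶜ = 0) (hν0 : ν (Set.Ici 0)ᶜ = 0)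
    (hμ : FiniteMoments μ) (hν : FiniteMoments ν) (heq : ∀ k : ℕ, ∫ x, x ^ k ∂μ = ∫ x, x ^ k ∂ν)
    {l : ℕ → ℝ} (hl : Monotone l) (hpos : ∀ k, 0 < l k)
    (hratio : ∀ k, ∫ x, x ^ (k + 1) ∂μ ≤ l k ^ 2 * ∫ x, x ^ k ∂μ)
    (hsum : ¬ Summable fun k => 1 / l k) : μ = ν := by
  have h : sqrtSymm μ = sqrtSymm ν := by
    refine measure_eq_of_moments_eq hμ.sqrtSymm hν.sqrtSymm (fun n => ?_) hl hpos (fun k => ?_) hsum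
    · rcases Nat.even_or_odd' n with ⟨k, rfl | rfl⟩
      · rw [integral_even_pow_sqrtSymm hμ hμ0, integral_even_pow_sqrtSymm hν hν0, heq]
      · rw [integral_pow_sqrtSymm hμ, integral_pow_sqrtSymm hν]
        simp [pow_succ, pow_mul]
    · rw [integral_even_pow_sqrtSymm hμ hμ0, integral_even_pow_sqrtSymm hμ hμ0]
      linarith [hratio k]
  have h2 : μ + μ = ν + ν := by rw [← map_sq_sqrtSymm hμ0, h, map_sq_sqrtSymm hν0]
  ext s hs
  have h3 := congrArg (fun ρ : Measure ℝ => ρ s) h2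
  simp only [Measure.add_apply, ← two_mul] at h3
  exact (ENNReal.mul_right_inj two_ne_zero (by simp)).1 h3

/-! ### Growth of the moments. -/

/-- If `N k` is a point past which `a` exceeds `k + 3`, then divergence of `∑ a n / n ^ 2` forces
divergence of `∑ 1 / N k`. -/
lemma not_summable_one_div_of_tendsto {a : ℕ → ℝ} {n₀ : ℕ} (ha : MonotoneOn a (Set.Ici n₀))
    (hsum : Tendsto (fun T : ℕ => ∑ n ∈ Finset.Icc n₀ T, a n / (n : ℝ) ^ 2) atTop atTop)
    {N : ℕ → ℕ} (hN0 : ∀ k, 0 < N k)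
    (hN : ∀ k n : ℕ, n₀ ≤ n → (k : ℝ) + 3 ≤ a n → N k ≤ n) :
    ¬ Summable fun k => 1 / (N k : ℝ) := by
  intro hs
  have hsq : Summable fun n : ℕ => 1 / (n : ℝ) ^ 2 := Real.summable_one_div_nat_pow.2 one_lt_two
  have hbound : ∀ T : ℕ, ∑ n ∈ Finset.Icc n₀ T, a n / (n : ℝ) ^ 2 ≤
      3 * (∑' n : ℕ, 1 / (n : ℝ) ^ 2) + 2 * ∑' k, 1 / (N k : ℝ) := by
    intro T
    -- By monotonicity, this cutoff catches every `k < a n - 3` for all `n ≤ T`.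
    set K := ⌈a T⌉₊
    have hcount : ∀ n ∈ Finset.Icc n₀ T,
        a n ≤ 3 + ∑ k ∈ Finset.range K, if N k ≤ n then (1 : ℝ) else 0 := by
      intro n hn
      obtain ⟨hn1, hn2⟩ := Finset.mem_Icc.1 hn
      have haT : a n ≤ a T := ha hn1 (hn1.trans hn2 : n₀ ≤ T) hn2
      have hsub : Finset.range ⌈a n - 3⌉₊ ⊆ (Finset.range K).filter fun k => N k ≤ n := by
        intro k hk
        have hk' : (k : ℝ) < a n - 3 := Nat.lt_ceil.1 (Finset.mem_range.1 hk)
        rw [Finset.mem_filter, Finset.mem_range]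
        exact ⟨Nat.lt_ceil.2 (by linarith), hN k n hn1 (by linarith)⟩
      have hcard := Finset.card_le_card hsub
      rw [Finset.card_range] at hcard
      have hcard' : ((⌈a n - 3⌉₊ : ℕ) : ℝ) ≤
          (((Finset.range K).filter fun k => N k ≤ n).card : ℝ) := by exact_mod_cast hcard
      rw [Finset.sum_boole]
      linarith [Nat.le_ceil (a n - 3)]
    -- Tail bound `∑_{n ≥ N} 1 / n ^ 2 ≤ 2 / N`.
    have hinner : ∀ k, ∑ n ∈ Finset.Icc n₀ T, (if N k ≤ n then (1 : ℝ) else 0) / (n : ℝ) ^ 2 ≤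
        2 * (1 / (N k : ℝ)) := by
      intro k
      have h1 := sum_Ioo_inv_sq_le (α := ℝ) (N k - 1) (T + 1)
      rw [Nat.cast_pred (hN0 k), sub_add_cancel] at h1
      rw [mul_one_div]
      refine le_trans ?_ h1
      simp_rw [ite_div, zero_div, one_div]
      rw [← Finset.sum_filter]
      refine Finset.sum_le_sum_of_subset_of_nonneg (fun n hn => ?_) fun _ _ _ => by positivity
      have := hN0 k
      rw [Finset.mem_filter, Finset.mem_Icc] at hn
      rw [Finset.mem_Ioo]
      omega
    calc ∑ n ∈ Finset.Icc n₀ T, a n / (n : ℝ) ^ 2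
        ≤ ∑ n ∈ Finset.Icc n₀ T,
            (3 + ∑ k ∈ Finset.range K, if N k ≤ n then (1 : ℝ) else 0) / (n : ℝ) ^ 2 := by
          refine Finset.sum_le_sum fun n hn => ?_
          gcongr
          exact hcount n hn
      _ = 3 * ∑ n ∈ Finset.Icc n₀ T, 1 / (n : ℝ) ^ 2 + ∑ k ∈ Finset.range K,
            ∑ n ∈ Finset.Icc n₀ T, (if N k ≤ n then (1 : ℝ) else 0) / (n : ℝ) ^ 2 := by
          rw [Finset.sum_comm, Finset.mul_sum, ← Finset.sum_add_distrib]
          refine Finset.sum_congr rfl fun n _ => ?_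
          rw [add_div, Finset.sum_div, mul_one_div]
      _ ≤ 3 * (∑' n : ℕ, 1 / (n : ℝ) ^ 2) + 2 * ∑' k, 1 / (N k : ℝ) := by
          gcongr
          · exact hsq.sum_le_tsum _ fun _ _ => by positivity
          · refine (Finset.sum_le_sum fun k _ => hinner k).trans ?_
            rw [← Finset.mul_sum]
            gcongr
            exact hs.sum_le_tsum _ fun _ _ => by positivity
  obtain ⟨T, hT⟩ := (hsum.eventually_gt_atTop
    (3 * (∑' n : ℕ, 1 / (n : ℝ) ^ 2) + 2 * ∑' k, 1 / (N k : ℝ))).exists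
  exact absurd (hbound T) (not_le.2 hT)

/-- The hypothesis says `p / 2 ≤ n ^ (-(k + 3))`; the surplus of `2` in the exponent leaves a
summable bound. -/
lemma pow_mul_le_of_le_neg_log_div_log {n : ℕ} (hn : 2 ≤ n) {p : ℝ} (hp : 0 < p) {k : ℕ}
    (h : (k : ℝ) + 3 ≤ -Real.log (p / 2) / Real.log n) :
    p * (n : ℝ) ^ (k + 1) ≤ 2 * (1 / (n : ℝ) ^ 2) := by
  have hn' : (1 : ℝ) < n := by exact_mod_cast hn
  have hn0 : (0 : ℝ) < n := by linarith
  rw [le_div_iff₀ (Real.log_pos hn')] at h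
  have h1 : Real.log (p / 2 * (n : ℝ) ^ (k + 3)) ≤ 0 := by
    rw [Real.log_mul (by positivity) (by positivity), Real.log_pow]
    push_cast
    linarith
  have h2 : p / 2 * (n : ℝ) ^ (k + 3) ≤ 1 := by
    by_contra! hlt
    exact absurd (Real.log_pos hlt) (not_lt.2 h1)
  rw [mul_one_div, le_div_iff₀ (by positivity)]
  calc p * (n : ℝ) ^ (k + 1) * (n : ℝ) ^ 2 = 2 * (p / 2 * (n : ℝ) ^ (k + 3)) := by ring
    _ ≤ 2 := by linarith

/-- Below `N`, one factor `n` is at most `N`; from `N` on, the terms are summable uniformly in `k`.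
-/
lemma integral_natPow_succ_le {ν : Measure ℕ} [IsProbabilityMeasure ν]
    (hmom : ∀ k : ℕ, Integrable (fun n : ℕ => (n : ℝ) ^ k) ν) {N k : ℕ}
    (h : ∀ n, N ≤ n → ν.real {n} * (n : ℝ) ^ (k + 1) ≤ 2 * (1 / (n : ℝ) ^ 2)) :
    ∫ n : ℕ, (n : ℝ) ^ (k + 1) ∂ν ≤
      N * (∫ n : ℕ, (n : ℝ) ^ k ∂ν) + 2 * ∑' n : ℕ, 1 / (n : ℝ) ^ 2 := by
  have hsq : Summable fun n : ℕ => 2 * (1 / (n : ℝ) ^ 2) :=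
    (Real.summable_one_div_nat_pow.2 one_lt_two).mul_left 2
  set F : ℕ → ℝ := (Set.Ici N).indicator fun n => (n : ℝ) ^ (k + 1) with hF
  have hFint : Integrable F ν := (hmom (k + 1)).indicator measurableSet_Ici
  have hFsum : ∫ n, F n ∂ν ≤ 2 * ∑' n : ℕ, 1 / (n : ℝ) ^ 2 := by
    have hle : ∀ n, ν.real {n} * F n ≤ 2 * (1 / (n : ℝ) ^ 2) := by
      intro n
      by_cases hn : n ∈ Set.Ici N
      · rw [hF, Set.indicator_of_mem hn]
        exact h n hn
      · rw [hF, Set.indicator_of_notMem hn, mul_zero]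
        positivity
    have hnn : ∀ n, 0 ≤ ν.real {n} * F n := fun n =>
      mul_nonneg measureReal_nonneg (Set.indicator_nonneg (fun _ _ => by positivity) n)
    rw [integral_countable hFint, ← tsum_mul_left]
    simp only [smul_eq_mul]
    exact (Summable.of_nonneg_of_le hnn hle hsq).tsum_le_tsum hle hsq
  calc ∫ n : ℕ, (n : ℝ) ^ (k + 1) ∂ν ≤ ∫ n : ℕ, (N * (n : ℝ) ^ k + F n) ∂ν := by
        refine integral_mono (hmom _) (((hmom k).const_mul _).add hFint) fun n => ?_
        by_cases hn : n ∈ Set.Ici N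
        · simp only [hF, Set.indicator_of_mem hn]
          have : (0 : ℝ) ≤ N * (n : ℝ) ^ k := by positivity
          linarith
        · simp only [hF, Set.indicator_of_notMem hn, add_zero]
          have : (n : ℝ) ≤ N := by exact_mod_cast (not_le.1 hn).le
          rw [pow_succ']
          gcongr
    _ ≤ _ := by
        rw [integral_add ((hmom k).const_mul _) hFint, integral_const_mul]
        linarith

/-- The atom at `1` bounds all moments below uniformly in `k`, which lets the additive constant be
absorbed into `C`. -/
lemma real_singleton_one_le_integral_natPow {ν : Measure ℕ} [IsProbabilityMeasure ν] {k : ℕ}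
    (hmom : Integrable (fun n : ℕ => (n : ℝ) ^ k) ν) :
    ν.real {1} ≤ ∫ n : ℕ, (n : ℝ) ^ k ∂ν := by
  rw [← integral_indicator_one (measurableSet_singleton 1)]
  refine integral_mono ((integrable_const 1).indicator (measurableSet_singleton 1)) hmom fun n => ?_
  by_cases hn : n = 1
  · simp [hn]
  · simp [Set.indicator, hn]

/-- Under the decay hypotheses, the ratios of consecutive moments have a monotone majorant `R`
with `∑ 1 / R k = ∞`. -/
theorem exists_moment_ratio_majorant {ν : Measure ℕ} [IsProbabilityMeasure ν]
    (hpos : ∀ n, 0 < ν.real {n}) (hmom : ∀ k : ℕ, Integrable (fun n : ℕ => (n : ℝ) ^ k) ν)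
    {n₀ : ℕ} (hn₀ : 2 ≤ n₀)
    (hsum : Tendsto (fun N : ℕ => ∑ n ∈ Finset.Icc n₀ N,
      (-Real.log (ν.real {n})) / ((n : ℝ) ^ 2 * Real.log n)) atTop atTop)
    (hmono : MonotoneOn (fun n : ℕ => (-Real.log (ν.real {n} / 2)) / Real.log n) (Set.Ici n₀))
    (hlim : Tendsto (fun n : ℕ => (-Real.log (ν.real {n} / 2)) / Real.log n) atTop atTop) :
    ∃ R : ℕ → ℝ, Monotone R ∧ (∀ k, 1 ≤ R k) ∧ (¬ Summable fun k => 1 / R k) ∧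
      ∀ k, ∫ n : ℕ, (n : ℝ) ^ (k + 1) ∂ν ≤ R k * ∫ n : ℕ, (n : ℝ) ^ k ∂ν := by
  classical
  set a : ℕ → ℝ := fun n => (-Real.log (ν.real {n} / 2)) / Real.log n with ha
  have hex : ∀ k : ℕ, ∃ n, n₀ ≤ n ∧ (k : ℝ) + 3 ≤ a n := fun k =>
    ((eventually_ge_atTop n₀).and (hlim.eventually_ge_atTop ((k : ℝ) + 3))).exists
  set N : ℕ → ℕ := fun k => Nat.find (hex k) with hN
  have hNspec : ∀ k, n₀ ≤ N k ∧ (k : ℝ) + 3 ≤ a (N k) := fun k => Nat.find_spec (hex k)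
  have hNmin : ∀ k n : ℕ, n₀ ≤ n → (k : ℝ) + 3 ≤ a n → N k ≤ n := fun k n h1 h2 =>
    Nat.find_min' (hex k) ⟨h1, h2⟩
  have hNmono : Monotone N := by
    intro j k hjk
    refine hNmin j _ (hNspec k).1 (le_trans ?_ (hNspec k).2)
    have : (j : ℝ) ≤ k := by exact_mod_cast hjk
    linarith
  have hN1 : ∀ k, (1 : ℝ) ≤ N k := fun k => by
    have : 1 ≤ N k := by have := (hNspec k).1; omega
    exact_mod_cast this
  have hN0 : ∀ k, 0 < N k := fun k => by have := (hNspec k).1; omega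
  -- Halving `p n` only increases `-log`.
  have hasum : Tendsto (fun T : ℕ => ∑ n ∈ Finset.Icc n₀ T, a n / (n : ℝ) ^ 2) atTop atTop := by
    refine tendsto_atTop_mono (fun T => Finset.sum_le_sum fun n hn => ?_) hsum
    have hn1 : (1 : ℝ) < n := by
      have : 1 < n := by have := (Finset.mem_Icc.1 hn).1; omega
      exact_mod_cast this
    have hlog := Real.log_pos hn1
    rw [mul_comm, ← div_div]
    simp only [ha]
    gcongr
    · exact div_pos (hpos n) two_pos
    · linarith [hpos n]
  have hns := not_summable_one_div_of_tendsto hmono hasum hN0 hNmin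
  set C : ℝ := 1 + (2 * ∑' n : ℕ, 1 / (n : ℝ) ^ 2) / ν.real {1} with hC
  have hS0 : 0 ≤ 2 * ∑' n : ℕ, 1 / (n : ℝ) ^ 2 :=
    mul_nonneg two_pos.le (tsum_nonneg fun _ => by positivity)
  have hC1 : 1 ≤ C := le_add_of_nonneg_right (div_nonneg hS0 (hpos 1).le)
  refine ⟨fun k => C * N k, fun j k hjk => ?_, fun k => one_le_mul_of_one_le_of_one_le hC1 (hN1 k),
    fun h => hns ?_, fun k => ?_⟩
  · have : (N j : ℝ) ≤ N k := by exact_mod_cast hNmono hjk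
    exact mul_le_mul_of_nonneg_left this (by linarith)
  · refine (h.mul_left C).congr fun k => ?_
    have : C ≠ 0 := by linarith
    have := hN1 k
    field_simp
  · have h1 := integral_natPow_succ_le hmom (N := N k) (k := k) fun n hn => by
      have hnn : n₀ ≤ n := (hNspec k).1.trans hn
      exact pow_mul_le_of_le_neg_log_div_log (hn₀.trans hnn) (hpos n)
        ((hNspec k).2.trans (hmono (hNspec k).1 hnn hn))
    have h2 := real_singleton_one_le_integral_natPow (hmom k)
    set m := ∫ n : ℕ, (n : ℝ) ^ k ∂ν
    have hm0 : 0 < m := (hpos 1).trans_le h2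
    refine h1.trans ?_
    have h3 : 2 * ∑' n : ℕ, 1 / (n : ℝ) ^ 2 ≤
        (2 * ∑' n : ℕ, 1 / (n : ℝ) ^ 2) / ν.real {1} * (N k * m) := by
      rw [div_mul_eq_mul_div, le_div_iff₀ (hpos 1)]
      refine mul_le_mul_of_nonneg_left (h2.trans ?_) hS0
      exact le_mul_of_one_le_left hm0.le (hN1 k)
    calc _ ≤ N k * m + (2 * ∑' n : ℕ, 1 / (n : ℝ) ^ 2) / ν.real {1} * (N k * m) := by gcongr
      _ = C * N k * m := by rw [hC]; ring

/-! ### Carleman's condition and conclusion. -/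

/-- By monotonicity each odd term dominates the next even one. -/
lemma not_summable_one_div_odd {R : ℕ → ℝ} (hR : Monotone R) (hR1 : ∀ k, 1 ≤ R k)
    (hns : ¬ Summable fun k => 1 / R k) : ¬ Summable fun k => 1 / R (2 * k + 1) := by
  intro hodd
  apply hns
  have hpos : ∀ k, 0 < R k := fun k => one_pos.trans_le (hR1 k)
  have hle : ∀ k, 1 / R (2 * (k + 1)) ≤ 1 / R (2 * k + 1) := fun k =>
    one_div_le_one_div_of_le (hpos _) (hR (by omega))
  have heven : Summable fun k => 1 / R (2 * k) :=
    (summable_nat_add_iff 1).1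
      (Summable.of_nonneg_of_le (fun k => (one_div_pos.2 (hpos (2 * (k + 1)))).le) hle hodd)
  exact (HasSum.even_add_odd (f := fun k => 1 / R k) heven.hasSum hodd.hasSum).summable

/-- Iterating the ratios gives `m k ≤ R k ^ k`, so the Carleman term is at least `R k ^ (-1 / 2) ≥ 1
/ R k`. -/
lemma stieltjesCarleman_of_ratio_le {μ : Measure ℝ} [IsProbabilityMeasure μ] {R : ℕ → ℝ}
    (hR : Monotone R) (hR1 : ∀ k, 1 ≤ R k) (hns : ¬ Summable fun k => 1 / R k)
    (hpos : ∀ k : ℕ, 0 < ∫ x, x ^ k ∂μ)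
    (hratio : ∀ k, ∫ x, x ^ (k + 1) ∂μ ≤ R k * ∫ x, x ^ k ∂μ) : StieltjesCarleman μ := by
  have hR0 : ∀ k, 0 < R k := fun k => one_pos.trans_le (hR1 k)
  have hle : ∀ k : ℕ, ∫ x, x ^ k ∂μ ≤ R k ^ k := by
    intro k
    induction k with
    | zero => simp
    | succ k ih =>
      calc ∫ x, x ^ (k + 1) ∂μ ≤ R k * ∫ x, x ^ k ∂μ := hratio k
        _ ≤ R (k + 1) * R (k + 1) ^ k := by
          have h1 := hR (Nat.le_succ k)
          refine mul_le_mul h1 (ih.trans ?_) (hpos k).le (hR0 _).le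
          exact pow_le_pow_left₀ (hR0 k).le h1 k
        _ = R (k + 1) ^ (k + 1) := (pow_succ' _ _).symm
  have hterm : ∀ k : ℕ, 1 ≤ k → 1 / R k ≤ moment id k μ ^ (-(1 / (2 * (k : ℝ)))) := by
    intro k hk
    have hk0 : (0 : ℝ) < k := by exact_mod_cast hk
    have hmom : moment id k μ = ∫ x, x ^ k ∂μ := by simp [moment]
    rw [hmom]
    calc 1 / R k = R k ^ (-1 : ℝ) := by rw [Real.rpow_neg_one, one_div]
      _ ≤ R k ^ ((k : ℝ) * (-(1 / (2 * (k : ℝ))))) := by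
        refine Real.rpow_le_rpow_of_exponent_le (hR1 k) ?_
        field_simp
        norm_num
      _ = (R k ^ k) ^ (-(1 / (2 * (k : ℝ)))) := by
        rw [Real.rpow_mul (hR0 k).le, Real.rpow_natCast]
      _ ≤ _ := Real.rpow_le_rpow_of_nonpos (hpos k) (hle k) (by
        rw [neg_nonpos]; positivity)
  have hns' : ¬ Summable fun k => 1 / R (k + 1) := fun h => hns ((summable_nat_add_iff 1).1 h)
  rw [not_summable_iff_tendsto_nat_atTop_of_nonneg
    fun k => (one_div_pos.2 (hR0 _)).le] at hns'
  refine tendsto_atTop_mono (fun n => ?_) hns'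
  rw [Finset.range_eq_Ico, Finset.sum_Ico_add' (fun k => 1 / R k) 0 n 1]
  exact Finset.sum_le_sum fun k hk => hterm k (Finset.mem_Icc.1 hk).1

/-- For the law of `Y`, determinacy is stated among all distributions on the real line, which
includes determinacy on the half-line; for `Y ^ 2` it is stated on the half-line. -/
theorem theorem4 {Ω : Type*} [MeasurableSpace Ω] (P : Measure Ω) [IsProbabilityMeasure P]
    (Y : Ω → ℕ) (hY : Measurable Y)
    (p : ℕ → ℝ) (hp : ∀ n, p n = P.real {ω | Y ω = n}) (hpos : ∀ n, 0 < p n)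
    (hmom : ∀ k : ℕ, Integrable (fun ω => (Y ω : ℝ) ^ k) P)
    (n₀ : ℕ) (hn₀ : 2 ≤ n₀)
    (hsum : Tendsto (fun N : ℕ => ∑ n ∈ Finset.Icc n₀ N,
      (-Real.log (p n)) / ((n : ℝ) ^ 2 * Real.log n)) atTop atTop)
    (hmono : MonotoneOn (fun n : ℕ => (-Real.log (p n / 2)) / Real.log n) (Set.Ici n₀))
    (hlim : Tendsto (fun n : ℕ => (-Real.log (p n / 2)) / Real.log n) atTop atTop) :
    StieltjesCarleman (P.map (fun ω => (Y ω : ℝ))) ∧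
      MomentDeterminateOn Set.univ (P.map (fun ω => (Y ω : ℝ))) ∧
      MomentDeterminateOn (Set.Ici 0) (P.map (fun ω => (Y ω : ℝ) ^ 2)) := by
  have hYr : Measurable fun ω => (Y ω : ℝ) := by fun_prop
  have hYr2 : Measurable fun ω => (Y ω : ℝ) ^ 2 := by fun_prop
  have hνp : ∀ n, (P.map Y).real {n} = p n := fun n => by
    rw [hp, map_measureReal_apply hY (measurableSet_singleton n)]
    rfl
  have hνmom : ∀ k : ℕ, Integrable (fun n : ℕ => (n : ℝ) ^ k) (P.map Y) := fun k =>
    (integrable_map_measure (by fun_prop) hY.aemeasurable).2 (hmom k)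
  have : IsProbabilityMeasure (P.map Y) := Measure.isProbabilityMeasure_map hY.aemeasurable
  have : IsProbabilityMeasure (P.map fun ω => (Y ω : ℝ)) :=
    Measure.isProbabilityMeasure_map hYr.aemeasurable
  have : IsProbabilityMeasure (P.map fun ω => (Y ω : ℝ) ^ 2) :=
    Measure.isProbabilityMeasure_map hYr2.aemeasurable
  have hνint : ∀ k : ℕ, ∫ n : ℕ, (n : ℝ) ^ k ∂(P.map Y) = ∫ ω, (Y ω : ℝ) ^ k ∂P := fun k =>
    integral_map hY.aemeasurable (by fun_prop)
  simp only [← hνp] at hpos hsum hmono hlim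
  obtain ⟨R, hR, hR1, hns, hratio⟩ :=
    exists_moment_ratio_majorant hpos hνmom hn₀ hsum hmono hlim
  have hmpos : ∀ k : ℕ, 0 < ∫ ω, (Y ω : ℝ) ^ k ∂P := fun k => by
    rw [← hνint]
    exact (hpos 1).trans_le (real_singleton_one_le_integral_natPow (hνmom k))
  simp only [hνint] at hratio
  have hint : ∀ k : ℕ, ∫ x, x ^ k ∂(P.map fun ω => (Y ω : ℝ)) = ∫ ω, (Y ω : ℝ) ^ k ∂P := fun k =>
    integral_map hYr.aemeasurable (by fun_prop)
  have hint2 : ∀ k : ℕ, ∫ x, x ^ k ∂(P.map fun ω => (Y ω : ℝ) ^ 2) =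
      ∫ ω, (Y ω : ℝ) ^ (2 * k) ∂P := fun k => by
    rw [integral_map hYr2.aemeasurable (by fun_prop)]
    simp only [pow_mul]
  have hfin : FiniteMoments (P.map fun ω => (Y ω : ℝ)) := fun k =>
    (integrable_map_measure (by fun_prop) hYr.aemeasurable).2 (hmom k)
  have hfin2 : FiniteMoments (P.map fun ω => (Y ω : ℝ) ^ 2) := fun k => by
    refine (integrable_map_measure (by fun_prop) hYr2.aemeasurable).2 ?_
    simpa only [Function.comp_def, pow_mul] using hmom (2 * k)
  have hsupp : (P.map fun ω => (Y ω : ℝ) ^ 2) (Set.Ici 0)ᶜ = 0 := by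
    rw [Measure.map_apply hYr2 measurableSet_Ici.compl]
    convert measure_empty (μ := P)
    ext ω
    simp
  -- Two successive ratios, both at most `R (2 * k + 1)`: this bounds even moments of `Y` and,
  -- equally, consecutive moments of `Y ^ 2`.
  have hratio2 : ∀ k, ∫ ω, (Y ω : ℝ) ^ (2 * (k + 1)) ∂P ≤
      R (2 * k + 1) ^ 2 * ∫ ω, (Y ω : ℝ) ^ (2 * k) ∂P := fun k =>
    calc ∫ ω, (Y ω : ℝ) ^ (2 * (k + 1)) ∂P
        ≤ R (2 * k + 1) * (R (2 * k) * ∫ ω, (Y ω : ℝ) ^ (2 * k) ∂P) :=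
          (hratio (2 * k + 1)).trans
            (mul_le_mul_of_nonneg_left (hratio (2 * k)) (zero_le_one.trans (hR1 _)))
      _ ≤ R (2 * k + 1) * (R (2 * k + 1) * ∫ ω, (Y ω : ℝ) ^ (2 * k) ∂P) :=
          mul_le_mul_of_nonneg_left
            (mul_le_mul_of_nonneg_right (hR (Nat.le_succ _)) (hmpos _).le)
            (zero_le_one.trans (hR1 _))
      _ = _ := by ring
  have hmonoR : Monotone fun k => R (2 * k + 1) := fun i j hij => hR (by omega)
  have hposR : ∀ k, 0 < R (2 * k + 1) := fun k => one_pos.trans_le (hR1 _)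
  have hnsR := not_summable_one_div_odd hR hR1 hns
  have heq_of_moment : ∀ (μ ν : Measure ℝ) [IsProbabilityMeasure μ] [IsProbabilityMeasure ν],
      (∀ k : ℕ, 1 ≤ k → moment id k ν = moment id k μ) →
      ∀ k : ℕ, ∫ x, x ^ k ∂μ = ∫ x, x ^ k ∂ν := by
    intro μ ν _ _ h k
    rcases Nat.eq_zero_or_pos k with rfl | hk
    · simp
    · simpa [moment] using (h k hk).symm
  refine ⟨stieltjesCarleman_of_ratio_le hR hR1 hns (fun k => by rw [hint]; exact hmpos k)
    (fun k => by rw [hint, hint]; exact hratio k), ⟨by simp, hfin, fun ν _ _ hν h => ?_⟩,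
    ⟨hsupp, hfin2, fun ν _ hν0 hν h => ?_⟩⟩
  · exact (measure_eq_of_moments_eq hfin hν (heq_of_moment _ ν h) hmonoR hposR
      (fun k => by rw [hint, hint]; exact hratio2 k) hnsR).symm
  · exact (measure_eq_of_moments_eq_of_nonneg hsupp hν0 hfin2 hν (heq_of_moment _ ν h) hmonoR hposR
      (fun k => by rw [hint2, hint2]; exact hratio2 k) hnsR).symm
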